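/- Logarithms are to base $2$. Let $\mathcal H_A,\mathcal H_B$ be finite-dimensional complex Hilbert spaces, $\mathcal H_{AB}=\mathcal H_A\otimes\mathcal H_B$. Write $S_=(\mathcal H)=\{\rho\ge 0:\operatorname{tr}\rho=1\}$ and $S_\le(\mathcal H)=\{\rho\ge 0: 0<\operatorname{tr}\rho\le 1\}$. For $\rho,\sigma\in S_\le(\mathcal H)$ let $$F(\rho,\sigma)=\|\sqrt\rho\sqrt\sigma\|_1+\sqrt{(1-\operatorname{tr}\rho)(1-\operatorname{tr}\sigma)},\qquad P(\rho,\sigma)=\sqrt{1-F(\rho,\sigma)^2},$$ and $\mathcal B^{\varepsilon}(\rho)=\{\rho'\in S_\le(\mathcal H):P(\rho,\rho')\le\varepsilon\}$. For positive semidefinite $\rho,\sigma$ let $D_{\max}(\rho\|\sigma)=\min\{\lambda\in\mathbb R: 2^\lambda\sigma\ge\rho\}$, with value $+\infty$ if no such $\lambda$ exists (and $-\infty$ if $\rho=0$). For $\rho\in S_\le(\mathcal H_{AB})$ with reduced operators $\rho_A,\rho_B$ let $${}^1I_{\max}(A{:}B)_\rho=D_{\max}(\rho\|\rho_A\otimes\rho_B),\qquad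 {}^2I_{\max}(A{:}B)_\rho=\min_{\sigma_B\in S_=(\mathcal H_B)}D_{\max}(\rho\|\rho_A\otimes\sigma_B),$$ $${}^3I_{\max}(A{:}B)_\rho=\min_{\sigma_A\in S_=(\mathcal H_A),\,\sigma_B\in S_=(\mathcal H_B)}D_{\max}(\rho\|\sigma_A\otimes\sigma_B),$$ and ${}^iI^{\varepsilon}_{\max}(A{:}B)_\rho=\min_{\rho'\in\mathcal B^{\varepsilon}(\rho)}{}^iI_{\max}(A{:}B)_{\rho'}$ for $i=1,2,3$ (minima are understood as infima in $[-\infty,+\infty]$). Put $$f(\varepsilon,\varepsilon')=\log\!\left(\frac{1}{1-\sqrt{1-\varepsilon^2}}+\frac1{1-\varepsilon'}\right),\qquad g(\varepsilon)=\log\!\left(\frac{2(1-\varepsilon)+3}{(1-\varepsilon)(1-\sqrt{1-\varepsilon^2})}\right).$$ Let $\rho\in S_=(\mathcal H_{AB})$, $\varepsilon,\varepsilon'>0$, $\varepsilon''\ge 0$ with $\varepsilon+2\sqrt\varepsilon+\varepsilon'+\varepsilon''<1$. Then $${}^3I_{\max}^{\varepsilon+2\sqrt\varepsilon+\varepsilon'+\varepsilon''}(A{:}B)_\rho\le{}^1I_{\max}^{\varepsilon+2\sqrt\varepsilon+\varepsilon'+\varepsilon''}(A{:}B)_\rho\le{}^3I_{\max}^{\varepsilon''}(A{:}B)_\rho+f(\varepsilon',\varepsilon'')+g(\varepsilon).$$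 Together with the corresponding relations $${}^3I_{\max}^{\varepsilon'+\varepsilon''}(A{:}B)_\rho\le{}^2I_{\max}^{\varepsilon'+\varepsilon''}(A{:}B)_\rho\le{}^3I_{\max}^{\varepsilon''}(A{:}B)_\rho+f(\varepsilon',\varepsilon''),$$ $${}^2I_{\max}^{\varepsilon+2\sqrt\varepsilon+\varepsilon''}(A{:}B)_\rho\le{}^1I_{\max}^{\varepsilon+2\sqrt\varepsilon+\varepsilon''}(A{:}B)_\rho\le{}^2I_{\max}^{\varepsilon''}(A{:}B)_\rho+g(\varepsilon),$$ which hold as well, all three smooth max-informations are pairwise equivalent up to terms depending only on the smoothing parameters. -/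

import Mathlib

open scoped ComplexOrder MatrixOrder Kronecker

namespace MaxInfo

noncomputable section

/-! Operators on the finite-dimensional Hilbert spaces `H_A`, `H_B`, `H_A ⊗ H_B` are complex
matrices indexed by finite types `A`, `B`, `A × B` (the index types label orthonormal bases).
The order `≤` on matrices is the Loewner order: `M ≤ N` iff `N - M` is positive semidefinite. -/

section States

variable {H : Type*} [Fintype H]

/-- Normalized density operators. -/
def IsState (ρ : Matrix H H ℂ) : Prop :=
  ρ.PosSemidef ∧ ρ.trace = 1

/-- Subnormalized density operators: `ρ ≥ 0` and `0 < tr ρ ≤ 1`. -/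
def IsSubstate (ρ : Matrix H H ℂ) : Prop :=
  ρ.PosSemidef ∧ 0 < ρ.trace.re ∧ ρ.trace.re ≤ 1

variable [DecidableEq H]

/-- The trace norm `‖M‖₁ = tr √(M† M)`. -/
def traceNorm (M : Matrix H H ℂ) : ℝ :=
  (CFC.sqrt (M.conjTranspose * M)).trace.re

/-- The generalized fidelity `F(ρ, σ) = ‖√ρ √σ‖₁ + √((1 - tr ρ)(1 - tr σ))`. -/
def fidelity (ρ σ : Matrix H H ℂ) : ℝ :=
  traceNorm (CFC.sqrt ρ * CFC.sqrt σ) + Real.sqrt ((1 - ρ.trace.re) * (1 - σ.trace.re))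

/-- The purified distance `P(ρ, σ) = √(1 - F(ρ, σ)²)`. -/
def purifiedDistance (ρ σ : Matrix H H ℂ) : ℝ :=
  Real.sqrt (1 - fidelity ρ σ ^ 2)

/-- The ball of subnormalized states that are `ε`-close to `ρ` in purified distance. -/
def ball (ε : ℝ) (ρ : Matrix H H ℂ) : Set (Matrix H H ℂ) :=
  {ρ' | IsSubstate ρ' ∧ purifiedDistance ρ ρ' ≤ ε}

/-- The smoothed version of a functional `I` of states: its least value on the `ε`-ball. -/
def smooth (I : Matrix H H ℂ → EReal) (ε : ℝ) (ρ : Matrix H H ℂ) : EReal :=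
  ⨅ ρ' ∈ ball ε ρ, I ρ'

end States

/-- The max-relative entropy: the least real `x` with `2 ^ x σ ≥ ρ`; it is `⊤` when there is no
such `x`, that is when the support of `ρ` is not contained in that of `σ`. -/
def dmax {H : Type*} [Fintype H] (ρ σ : Matrix H H ℂ) : EReal :=
  ⨅ (x : ℝ) (_ : ρ ≤ ((2 : ℝ) ^ x) • σ), (x : EReal)

section Bipartite

variable {A B : Type*} [Fintype A] [Fintype B]

/-- The reduced operator on `A`, the partial trace over `B`. -/
def margA (ρ : Matrix (A × B) (A × B) ℂ) : Matrix A A ℂ :=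
  Matrix.of fun a a' => ∑ b, ρ (a, b) (a', b)

/-- The reduced operator on `B`, the partial trace over `A`. -/
def margB (ρ : Matrix (A × B) (A × B) ℂ) : Matrix B B ℂ :=
  Matrix.of fun b b' => ∑ a, ρ (a, b) (a, b')

/-- `¹I_max(A:B)_ρ = D_max(ρ_AB ‖ ρ_A ⊗ ρ_B)`. -/
def imax1 (ρ : Matrix (A × B) (A × B) ℂ) : EReal :=
  dmax ρ (margA ρ ⊗ₖ margB ρ)

/-- `²I_max(A:B)_ρ = min_{σ_B} D_max(ρ_AB ‖ ρ_A ⊗ σ_B)`, over normalized states `σ_B`. -/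
def imax2 (ρ : Matrix (A × B) (A × B) ℂ) : EReal :=
  ⨅ (σB : Matrix B B ℂ) (_ : IsState σB), dmax ρ (margA ρ ⊗ₖ σB)

/-- `³I_max(A:B)_ρ = min_{σ_A, σ_B} D_max(ρ_AB ‖ σ_A ⊗ σ_B)`, over normalized states. -/
def imax3 (ρ : Matrix (A × B) (A × B) ℂ) : EReal :=
  ⨅ (σA : Matrix A A ℂ) (_ : IsState σA) (σB : Matrix B B ℂ) (_ : IsState σB),
    dmax ρ (σA ⊗ₖ σB)

variable [DecidableEq A] [DecidableEq B]

/-- The smooth max-information `¹I_max^ε(A:B)_ρ`. -/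
def smoothImax1 (ε : ℝ) (ρ : Matrix (A × B) (A × B) ℂ) : EReal := smooth imax1 ε ρ

/-- The smooth max-information `²I_max^ε(A:B)_ρ`. -/
def smoothImax2 (ε : ℝ) (ρ : Matrix (A × B) (A × B) ℂ) : EReal := smooth imax2 ε ρ

/-- The smooth max-information `³I_max^ε(A:B)_ρ`. -/
def smoothImax3 (ε : ℝ) (ρ : Matrix (A × B) (A × B) ℂ) : EReal := smooth imax3 ε ρ

end Bipartite

/-- `f(ε, ε') = log₂(1 / (1 - √(1 - ε²)) + 1 / (1 - ε'))`. -/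
def fTerm (ε ε' : ℝ) : ℝ :=
  Real.logb 2 (1 / (1 - Real.sqrt (1 - ε ^ 2)) + 1 / (1 - ε'))

/-- `g(ε) = log₂((2(1 - ε) + 3) / ((1 - ε)(1 - √(1 - ε²))))`. -/
def gTerm (ε : ℝ) : ℝ :=
  Real.logb 2 ((2 * (1 - ε) + 3) / ((1 - ε) * (1 - Real.sqrt (1 - ε ^ 2))))

end

end MaxInfo

/-! The lower bounds hold pointwise: a marginal of a substate lies below its normalization, and
`dmax` decreases in its second argument. The upper bounds modify a near-optimal state in the ball so
that free product factors become marginals.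

Replacing `σA` by a marginal is done by a filter (`exists_filter`). With `m = ρ_A` and `Γ = m^{-1/2}
σA m^{-1/2}`, let `Q` project onto the eigenvalues of `Γ` at most `γ`, and put `G = m^{1/2} Q
m^{-1/2}`. Then `G σA Gᴴ ≤ γ G m Gᴴ`, and the right-hand side is `γ` times the new marginal. The
discarded trace is at most `1/γ`, because `Γ > γ` on the discarded eigenvectors. This gives the
comparison of the third and second quantities.

Filtering on `B` in the same way changes the `A` marginal too, leaving a bound by `ρ_A ⊗ τ_B` with
the old `ρ_A`. Mixing in a little of that product makes the new `A` marginal dominate a multiple of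
`ρ_A` (`mix_le_marg_kronecker_marg`), which compares the second and first quantities. Composing both
steps compares the third with the first.

Distances add by `purifiedDistance_triangle`, and fidelities are bounded below by exhibiting
explicit factors `X`, `Z` in `trace_le_traceNorm_sqrt`. -/

namespace MaxInfo

open Matrix

/-! ### Loewner order, spectral truncation and contractions. -/

section Operators

variable {H : Type*}

theorem smul_le_smul_of_le {M N : Matrix H H ℂ} (h : M ≤ N) {c : ℝ} (hc : 0 ≤ c) :
    c • M ≤ c • N := by
  rw [Matrix.le_iff, ← smul_sub]
  exact (Matrix.le_iff.1 h).smul hc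

theorem smul_le_smul_of_posSemidef {M : Matrix H H ℂ} (h : M.PosSemidef) {c d : ℝ} (hc : c ≤ d) :
    c • M ≤ d • M := by
  rw [Matrix.le_iff, ← sub_smul]
  exact h.smul (sub_nonneg.2 hc)

variable [Fintype H]

theorem conj_le_conj {M N : Matrix H H ℂ} (h : M ≤ N) (G : Matrix H H ℂ) :
    G * M * Gᴴ ≤ G * N * Gᴴ := by
  rw [Matrix.le_iff] at *
  have := h.mul_mul_conjTranspose_same G
  rwa [Matrix.mul_sub, Matrix.sub_mul] at this

theorem conjTranspose_conj_le_conj {M N : Matrix H H ℂ} (h : M ≤ N) (G : Matrix H H ℂ) :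
    Gᴴ * M * G ≤ Gᴴ * N * G := by
  simpa using conj_le_conj h Gᴴ

theorem trace_re_nonneg {M : Matrix H H ℂ} (h : M.PosSemidef) : 0 ≤ M.trace.re :=
  (Complex.le_def.1 h.trace_nonneg).1

theorem trace_re_mono {M N : Matrix H H ℂ} (h : M ≤ N) : M.trace.re ≤ N.trace.re := by
  have := trace_re_nonneg (Matrix.le_iff.1 h)
  rw [Matrix.trace_sub, Complex.sub_re] at this
  linarith

theorem trace_conjTranspose_re (M : Matrix H H ℂ) : Mᴴ.trace.re = M.trace.re := by
  rw [Matrix.trace_conjTranspose]; simp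

variable [DecidableEq H]

theorem continuousOn_spectrum (f : ℝ → ℝ) (M : Matrix H H ℂ) :
    ContinuousOn f (spectrum ℝ M) :=
  (Matrix.finite_real_spectrum (A := M)).continuousOn f

/-- The Moore-Penrose inverse of a Hermitian matrix. -/
theorem exists_pseudoInverse {S : Matrix H H ℂ} (hS : S.IsHermitian) :
    ∃ R : Matrix H H ℂ, R.IsHermitian ∧ S * R = R * S ∧ S * R * S = S ∧ R * S * R = R := by
  have hS' : IsSelfAdjoint S := hS
  have hc := fun f => continuousOn_spectrum f S
  have hid : cfc (fun x : ℝ => x) S = S := cfc_id' ℝ S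
  refine ⟨cfc (fun x : ℝ => x⁻¹) S, cfc_predicate (R := ℝ) (p := IsSelfAdjoint) _ S, ?_, ?_, ?_⟩
  · nth_rw 1 [← hid]; nth_rw 4 [← hid]
    exact cfc_commute_cfc _ _ S
  · conv_lhs => rw [← hid]
    rw [cfc_id' ℝ S]
    nth_rw 1 [← hid]; nth_rw 3 [← hid]
    rw [← cfc_mul _ _ S (hc _) (hc _), ← cfc_mul _ _ S (hc _) (hc _)]
    nth_rw 2 [← hid]
    congr 1; ext x
    exact mul_inv_mul_cancel x
  · nth_rw 2 [← hid]
    rw [← cfc_mul _ _ S (hc _) (hc _), ← cfc_mul _ _ S (hc _) (hc _)]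
    congr 1; ext x
    by_cases hx : x = 0 <;> simp [hx]

/-- The identity `(1 - P)² + (P - P²) = 1 - P` exhibits a sum of nonnegative terms. -/
theorem le_one_of_isHermitian_of_mul_self_le {P : Matrix H H ℂ} (hP : P.IsHermitian)
    (h : P * P ≤ P) : P ≤ 1 := by
  have h1 : 0 ≤ (1 - P)ᴴ * (1 - P) :=
    Matrix.nonneg_iff_posSemidef.2 (posSemidef_conjTranspose_mul_self _)
  rw [Matrix.conjTranspose_sub, hP.eq, Matrix.conjTranspose_one] at h1
  have h2 := add_nonneg h1 (sub_nonneg.2 h)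
  rw [← sub_nonneg]
  convert h2 using 1
  noncomm_ring

/-- The truncation of a positive semidefinite matrix to eigenvalues at most `γ`. -/
theorem exists_spectral_cutoff {Γ : Matrix H H ℂ} (hΓ : Γ.PosSemidef) (γ : ℝ) :
    ∃ Q : Matrix H H ℂ, Q.IsHermitian ∧ Q * Q = Q ∧ Q * Γ * Q ≤ γ • Q ∧
      γ • (1 - Q) ≤ Γ ∧ Q ≤ 1 ∧ ∀ T, Commute Γ T → Commute Q T := by
  have hS' : IsSelfAdjoint Γ := hΓ.isHermitian
  have hc := fun f => continuousOn_spectrum f Γ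
  have hid : cfc (fun x : ℝ => x) Γ = Γ := cfc_id' ℝ Γ
  set p : ℝ → ℝ := fun x => if x ≤ γ then 1 else 0 with hp
  have hH : (cfc p Γ).IsHermitian := cfc_predicate (R := ℝ) (p := IsSelfAdjoint) _ Γ
  have hQQ : cfc p Γ * cfc p Γ = cfc p Γ := by
    rw [← cfc_mul _ _ Γ (hc _) (hc _)]
    congr 1; ext x
    simp only [hp]; split_ifs <;> simp
  refine ⟨cfc p Γ, hH, hQQ, ?_, ?_, le_one_of_isHermitian_of_mul_self_le hH hQQ.le,
    fun T hT => hS'.commute_cfc hT p⟩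
  · nth_rw 2 [← hid]
    rw [← cfc_mul _ _ Γ (hc _) (hc _), ← cfc_mul _ _ Γ (hc _) (hc _),
      ← cfc_smul _ _ Γ (hc _)]
    refine cfc_mono (fun x _ => ?_) (hc _) (hc _)
    simp only [hp]; split_ifs with hx <;> simp [hx]
  · have h1 : (1 : Matrix H H ℂ) - cfc p Γ = cfc (fun x => 1 - p x) Γ := by
      rw [cfc_sub _ _ Γ (hc _) (hc _), cfc_const_one ℝ Γ]
    rw [h1, ← cfc_smul _ _ Γ (hc _)]
    nth_rw 2 [← hid]
    refine cfc_mono (fun x hx => ?_) (hc _) (hc _)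
    have hx0 : 0 ≤ x := spectrum_nonneg_of_nonneg (Matrix.nonneg_iff_posSemidef.2 hΓ) hx
    simp only [hp]; split_ifs with h
    · simpa using hx0
    · simp; linarith

/-- The square of `K Kᴴ` is `K (Kᴴ K) Kᴴ ≤ K Kᴴ`, so the previous criterion applies. -/
theorem mul_conjTranspose_le_one {K : Matrix H H ℂ} (h : Kᴴ * K ≤ 1) : K * Kᴴ ≤ 1 := by
  refine le_one_of_isHermitian_of_mul_self_le (isHermitian_mul_conjTranspose_self K) ?_
  simpa [Matrix.mul_assoc] using conj_le_conj h K

theorem conjTranspose_mul_mul_le_one {K L : Matrix H H ℂ} (hK : Kᴴ * K ≤ 1) (hL : Lᴴ * L ≤ 1) :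
    (K * L)ᴴ * (K * L) ≤ 1 := by
  refine le_trans ?_ hL
  simpa [Matrix.mul_assoc, conjTranspose_mul] using conjTranspose_conj_le_conj hK L

theorem mul_pseudoInverse_le_one {S R : Matrix H H ℂ} (hS : S.IsHermitian) (hR : R.IsHermitian)
    (hc : S * R = R * S) (h : S * R * S = S) : S * R ≤ 1 := by
  refine le_one_of_isHermitian_of_mul_self_le ?_ ?_
  · rw [IsHermitian, conjTranspose_mul, hS.eq, hR.eq, hc]
  · rw [← Matrix.mul_assoc, h]

/-- A form of Douglas' factorization lemma. -/
theorem exists_contraction_factor {S Z : Matrix H H ℂ} (hS : S.IsHermitian) (h : Z * Zᴴ ≤ S * S) :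
    ∃ V : Matrix H H ℂ, Vᴴ * V ≤ 1 ∧ Z = S * V := by
  obtain ⟨R, hR, hc, h1, h2⟩ := exists_pseudoInverse hS
  have hle := mul_pseudoInverse_le_one hS hR hc h1
  refine ⟨R * Z, ?_, ?_⟩
  · have hK : ((R * Z)ᴴ)ᴴ * (R * Z)ᴴ ≤ 1 := by
      refine le_trans ?_ hle
      have := conj_le_conj h R
      rw [hR.eq] at this
      rw [conjTranspose_conjTranspose, conjTranspose_mul, hR.eq]
      have e : R * (S * S) * R = S * R := by
        rw [← Matrix.mul_assoc, ← hc, h1]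
      rw [e] at this
      simpa [Matrix.mul_assoc] using this
    simpa using mul_conjTranspose_le_one hK
  · set D := (1 - S * R) * Z with hD
    have hPh : (1 - S * R)ᴴ = 1 - S * R := by
      rw [conjTranspose_sub, conjTranspose_one, conjTranspose_mul, hS.eq, hR.eq, hc]
    have h0 : (1 - S * R) * S = 0 := by rw [Matrix.sub_mul, h1, Matrix.one_mul, sub_self]
    have h3 : D * Dᴴ ≤ 0 := by
      have := conj_le_conj h (1 - S * R)
      rw [← Matrix.mul_assoc _ S S, h0] at this
      simpa [hD, Matrix.mul_assoc, conjTranspose_mul] using this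
    have h4 : D * Dᴴ = 0 := le_antisymm h3
      (Matrix.nonneg_iff_posSemidef.2 (posSemidef_self_mul_conjTranspose _))
    have h5 : D = 0 := self_mul_conjTranspose_eq_zero.1 h4
    rw [hD, Matrix.sub_mul, Matrix.one_mul, sub_eq_zero, Matrix.mul_assoc] at h5
    exact h5

end Operators

/-! ### Variational description of the trace norm. -/

section TraceNorm

variable {H : Type*} [Fintype H] [DecidableEq H]

theorem sqrt_posSemidef (ρ : Matrix H H ℂ) : (CFC.sqrt ρ).PosSemidef :=
  Matrix.nonneg_iff_posSemidef.1 (CFC.sqrt_nonneg ρ)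

theorem sqrt_mul_sqrt {ρ : Matrix H H ℂ} (hρ : ρ.PosSemidef) : CFC.sqrt ρ * CFC.sqrt ρ = ρ :=
  CFC.sqrt_mul_sqrt_self ρ (Matrix.nonneg_iff_posSemidef.2 hρ)

theorem traceNorm_nonneg (M : Matrix H H ℂ) : 0 ≤ traceNorm M :=
  trace_re_nonneg (sqrt_posSemidef _)

/-- Polar decomposition with a contraction. -/
theorem exists_polar (M : Matrix H H ℂ) : ∃ W : Matrix H H ℂ, Wᴴ * W ≤ 1 ∧
    M = W * CFC.sqrt (Mᴴ * M) ∧ Wᴴ * M = CFC.sqrt (Mᴴ * M) := by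
  have hsq := sqrt_mul_sqrt (posSemidef_conjTranspose_mul_self M)
  have hT := (sqrt_posSemidef (Mᴴ * M)).isHermitian
  set T := CFC.sqrt (Mᴴ * M)
  obtain ⟨V, hV, hM⟩ := exists_contraction_factor (S := T) (Z := Mᴴ) hT (by simp [hsq])
  have hM' : M = Vᴴ * T := by
    rw [← conjTranspose_conjTranspose M, hM, conjTranspose_mul, hT.eq]
  obtain ⟨R, hR, hc, h1, -⟩ := exists_pseudoInverse hT
  have hWM : (M * R)ᴴ * M = T := by
    rw [conjTranspose_mul, hR.eq, Matrix.mul_assoc, ← hsq, ← Matrix.mul_assoc, ← hc, h1]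
  refine ⟨M * R, ?_, ?_, hWM⟩
  · rw [← Matrix.mul_assoc, hWM]
    exact mul_pseudoInverse_le_one hT hR hc h1
  · rw [Matrix.mul_assoc, ← hc, hM', Matrix.mul_assoc, hc, ← Matrix.mul_assoc T, h1]

theorem trace_mul_re_le_of_contraction {C T : Matrix H H ℂ} (hC : Cᴴ * C ≤ 1)
    (hT : T.PosSemidef) : (C * T).trace.re ≤ T.trace.re := by
  have hS := (sqrt_posSemidef T).isHermitian
  have hsq := sqrt_mul_sqrt hT
  set S := CFC.sqrt T
  have h1 : 0 ≤ (1 - C)ᴴ * (1 - C) :=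
    Matrix.nonneg_iff_posSemidef.2 (posSemidef_conjTranspose_mul_self _)
  -- This is `(1 - C)ᴴ (1 - C) + (1 - Cᴴ C)`; compressing by `√T` bounds the real part of the trace.
  have h2 : 0 ≤ 1 + 1 - C - Cᴴ := by
    have := add_nonneg h1 (sub_nonneg.2 hC)
    convert this using 1
    rw [conjTranspose_sub, conjTranspose_one]
    noncomm_ring
  have h3 := trace_re_mono (conj_le_conj h2 S)
  have e1 : (S * C * S).trace = (C * T).trace := by
    rw [Matrix.mul_assoc, Matrix.trace_mul_comm, Matrix.mul_assoc, hsq]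
  have e2 : (S * Cᴴ * S).trace.re = (C * T).trace.re := by
    rw [← e1, ← trace_conjTranspose_re (S * C * S)]
    simp only [conjTranspose_mul, hS.eq, Matrix.mul_assoc]
  rw [hS.eq] at h3
  simp only [Matrix.mul_sub, Matrix.sub_mul, Matrix.mul_add, Matrix.add_mul, Matrix.mul_one,
    Matrix.mul_zero, Matrix.zero_mul, Matrix.trace_sub, Matrix.trace_add, Complex.sub_re,
    Complex.add_re, hsq, Matrix.trace_zero, Complex.zero_re, e1, e2] at h3
  linarith

theorem trace_mul_re_le_traceNorm {K : Matrix H H ℂ} (hK : Kᴴ * K ≤ 1) (M : Matrix H H ℂ) :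
    (K * M).trace.re ≤ traceNorm M := by
  obtain ⟨W, hW, hM, -⟩ := exists_polar M
  have := trace_mul_re_le_of_contraction (conjTranspose_mul_mul_le_one hK hW)
    (sqrt_posSemidef (Mᴴ * M))
  rwa [Matrix.mul_assoc, ← hM] at this

theorem exists_contraction_traceNorm (M : Matrix H H ℂ) :
    ∃ W : Matrix H H ℂ, Wᴴ * W ≤ 1 ∧ (Wᴴ * M).trace.re = traceNorm M := by
  obtain ⟨W, hW, -, hM⟩ := exists_polar M
  exact ⟨W, hW, by rw [hM, traceNorm]⟩

/-- The easy half of Uhlmann's theorem. -/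
theorem trace_le_traceNorm_sqrt {ρ τ X Z : Matrix H H ℂ} (hρ : ρ.PosSemidef) (hτ : τ.PosSemidef)
    (hX : X * Xᴴ ≤ ρ) (hZ : Z * Zᴴ ≤ τ) :
    (Xᴴ * Z).trace.re ≤ traceNorm (CFC.sqrt ρ * CFC.sqrt τ) := by
  have hS := (sqrt_posSemidef ρ).isHermitian
  obtain ⟨U, hU, rfl⟩ := exists_contraction_factor hS (by rwa [sqrt_mul_sqrt hρ])
  obtain ⟨V, hV, rfl⟩ := exists_contraction_factor (sqrt_posSemidef τ).isHermitian
    (by rwa [sqrt_mul_sqrt hτ])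
  have hU' : (Uᴴ)ᴴ * Uᴴ ≤ 1 := by simpa using mul_conjTranspose_le_one hU
  refine le_trans (le_of_eq ?_) (trace_mul_re_le_traceNorm (conjTranspose_mul_mul_le_one hV hU') _)
  rw [conjTranspose_mul, hS.eq, Matrix.mul_assoc V, Matrix.trace_mul_comm V]
  simp only [Matrix.mul_assoc]

theorem sqrt_mul_contraction_le {ρ W : Matrix H H ℂ} (hρ : ρ.PosSemidef) (hW : Wᴴ * W ≤ 1) :
    (CFC.sqrt ρ * W) * (CFC.sqrt ρ * W)ᴴ ≤ ρ := by
  have hr := (sqrt_posSemidef ρ).isHermitian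
  have := conj_le_conj (mul_conjTranspose_le_one hW) (CFC.sqrt ρ)
  rw [Matrix.mul_one, hr.eq, sqrt_mul_sqrt hρ] at this
  simpa [conjTranspose_mul, hr.eq, Matrix.mul_assoc] using this

theorem traceNorm_sqrt_sq_le {ρ τ : Matrix H H ℂ} (hρ : ρ.PosSemidef) (hτ : τ.PosSemidef) :
    traceNorm (CFC.sqrt ρ * CFC.sqrt τ) ^ 2 ≤ ρ.trace.re * τ.trace.re := by
  obtain ⟨W, hW, hWt⟩ := exists_contraction_traceNorm (CFC.sqrt ρ * CFC.sqrt τ)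
  have hxx := trace_re_mono (sqrt_mul_contraction_le hρ hW)
  rw [Matrix.trace_mul_comm] at hxx
  have hsh := (sqrt_posSemidef τ).isHermitian
  have hxs : ((CFC.sqrt ρ * W)ᴴ * CFC.sqrt τ).trace.re =
      traceNorm (CFC.sqrt ρ * CFC.sqrt τ) := by
    rw [← hWt, conjTranspose_mul, (sqrt_posSemidef ρ).isHermitian.eq, Matrix.mul_assoc]
  have hs := sqrt_mul_sqrt hτ
  set s := CFC.sqrt τ
  set x := CFC.sqrt ρ * W
  have hsx : (s * x).trace.re = (xᴴ * s).trace.re := by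
    rw [← trace_conjTranspose_re, conjTranspose_mul, hsh.eq]
  rw [← hxs]
  -- Cauchy–Schwarz for the Hilbert–Schmidt product: the squared norm of `α x + s` is nonnegative
  -- for all real `α`.
  have hd := discrim_le_zero (a := ρ.trace.re) (b := 2 * (xᴴ * s).trace.re) (c := τ.trace.re)
    (fun α => by
      have h0 := trace_re_nonneg (posSemidef_conjTranspose_mul_self ((α : ℂ) • x + s))
      simp only [conjTranspose_add, conjTranspose_smul, Matrix.add_mul, Matrix.mul_add,
        Matrix.smul_mul, Matrix.mul_smul, Matrix.trace_add, Matrix.trace_smul, Complex.add_re,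
        Complex.star_def, Complex.conj_ofReal, smul_eq_mul, Complex.re_ofReal_mul, hsh.eq, hs,
        hsx] at h0
      nlinarith [mul_le_mul_of_nonneg_left hxx (mul_self_nonneg α)])
  rw [discrim] at hd
  nlinarith

end TraceNorm

/-! ### Purified distance and its triangle inequality. -/

section PurifiedDistance

variable {H : Type*} [Fintype H] [DecidableEq H]

theorem fidelity_nonneg (ρ σ : Matrix H H ℂ) : 0 ≤ fidelity ρ σ :=
  add_nonneg (traceNorm_nonneg _) (Real.sqrt_nonneg _)

theorem purifiedDistance_le {ρ σ : Matrix H H ℂ} {x ε : ℝ} (hε : 0 ≤ ε) (hx : 0 ≤ x)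
    (h : x ≤ fidelity ρ σ) (hxε : 1 - ε ^ 2 ≤ x ^ 2) : purifiedDistance ρ σ ≤ ε := by
  refine Real.sqrt_le_iff.2 ⟨hε, ?_⟩
  nlinarith

/-- A spherical triangle inequality, phrased through the Gram matrix of three unit vectors. -/
theorem sqrt_one_sub_sq_le_add {a b c : ℝ} (ha : 0 ≤ a) (hb : 0 ≤ b)
    (h : ∀ α β κ : ℝ,
      0 ≤ α ^ 2 + β ^ 2 + κ ^ 2 + 2 * α * β * a + 2 * β * κ * b + 2 * α * κ * c) :
    ∀ F, 0 ≤ F → c ≤ F →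
      √(1 - F ^ 2) ≤ √(1 - a ^ 2) + √(1 - b ^ 2) := by
  intro F hF hcF
  have ha1 : 0 ≤ 1 - a ^ 2 := by have := h 1 (-a) 0; nlinarith
  have hb1 : 0 ≤ 1 - b ^ 2 := by have := h 0 (-b) 1; nlinarith
  -- The middle coefficient is the minimizer of the form, leaving the Schur complement of the middle
  -- vector.
  have hd := discrim_le_zero (a := 1 - a ^ 2) (b := 2 * (c - a * b)) (c := 1 - b ^ 2)
    (fun x => by have := h x (-(x * a + b)) 1; nlinarith)
  rw [discrim] at hd
  obtain ⟨p, hp0, hp⟩ : ∃ p, 0 ≤ p ∧ p ^ 2 = 1 - a ^ 2 := ⟨_, Real.sqrt_nonneg _, Real.sq_sqrt ha1⟩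
  obtain ⟨q, hq0, hq⟩ : ∃ q, 0 ≤ q ∧ q ^ 2 = 1 - b ^ 2 := ⟨_, Real.sqrt_nonneg _, Real.sq_sqrt hb1⟩
  rw [← hp, ← hq, Real.sqrt_sq hp0, Real.sqrt_sq hq0]
  refine Real.sqrt_le_iff.2 ⟨by positivity, ?_⟩
  -- With `a`, `b` cosines and `p`, `q` sines, this says that `c` is at least the cosine of the sum
  -- of the angles.
  have hc : a * b - p * q ≤ c := by
    have : (c - a * b) ^ 2 ≤ (p * q) ^ 2 := by rw [mul_pow, hp, hq]; linarith
    linarith [(abs_le_of_sq_le_sq' this (by positivity)).1]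
  have hpq : 0 ≤ p * q := by positivity
  rcases le_total (p * q) (a * b) with hle | hle
  · have h1 : (a * b - p * q) ^ 2 ≤ F ^ 2 :=
      pow_le_pow_left₀ (by linarith) (by linarith) 2
    have h2 : (a * b - p * q) ^ 2 = (1 - p ^ 2) * (1 - q ^ 2) - 2 * (a * b) * (p * q) +
        p ^ 2 * q ^ 2 := by
      rw [hp, hq]; nlinarith [hp, hq]
    have h3 : a * b ≤ 1 := by nlinarith [sq_nonneg (a - b)]
    nlinarith [mul_le_mul_of_nonneg_right h3 hpq, mul_nonneg hpq hpq]
  -- Angles summing to at least a right angle: here `p² + q² ≥ 1`, so the bound is trivial.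
  · have h1 : (a * b) ^ 2 ≤ (p * q) ^ 2 := pow_le_pow_left₀ (by positivity) hle 2
    rw [mul_pow, mul_pow, hp, hq] at h1
    nlinarith

theorem purifiedDistance_triangle {ρ σ τ : Matrix H H ℂ} (hρ : IsSubstate ρ) (hσ : IsSubstate σ)
    (hτ : IsSubstate τ) :
    purifiedDistance ρ τ ≤ purifiedDistance ρ σ + purifiedDistance σ τ := by
  obtain ⟨hρ, -, hρ1⟩ := hρ
  obtain ⟨hσ, -, hσ1⟩ := hσ
  obtain ⟨hτ, -, hτ1⟩ := hτ
  have hr := sqrt_mul_sqrt hρ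
  have hs := sqrt_mul_sqrt hσ
  have ht := sqrt_mul_sqrt hτ
  have hrh := (sqrt_posSemidef ρ).isHermitian
  have hsh := (sqrt_posSemidef σ).isHermitian
  have hth := (sqrt_posSemidef τ).isHermitian
  -- Both outer square roots are rotated so that their overlaps with `√σ` attain the two trace
  -- norms.
  obtain ⟨W, hW, hWt⟩ := exists_contraction_traceNorm (CFC.sqrt ρ * CFC.sqrt σ)
  obtain ⟨V, hV, hVt⟩ := exists_contraction_traceNorm (CFC.sqrt σ * CFC.sqrt τ)
  unfold purifiedDistance
  set r := CFC.sqrt ρ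
  set s := CFC.sqrt σ
  set t := CFC.sqrt τ
  have hx : (r * W) * (r * W)ᴴ ≤ ρ := sqrt_mul_contraction_le hρ hW
  have hz : (t * Vᴴ) * (t * Vᴴ)ᴴ ≤ τ :=
    sqrt_mul_contraction_le hτ (by simpa using mul_conjTranspose_le_one hV)
  have hxy : ((r * W)ᴴ * s).trace.re = traceNorm (r * s) := by
    rw [← hWt, conjTranspose_mul, hrh.eq, Matrix.mul_assoc]
  have hyz : (s * (t * Vᴴ)).trace.re = traceNorm (s * t) := by
    rw [← hVt, Matrix.trace_mul_comm Vᴴ, Matrix.mul_assoc]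
  have hxz := trace_le_traceNorm_sqrt hρ hτ hx hz
  have hxx := trace_re_mono hx
  have hzz := trace_re_mono hz
  rw [Matrix.trace_mul_comm] at hxx hzz
  set x := r * W
  set z := t * Vᴴ
  have hyx : (s * x).trace.re = (xᴴ * s).trace.re := by
    rw [← trace_conjTranspose_re, conjTranspose_mul, hsh.eq]
  have hzy : (zᴴ * s).trace.re = (s * z).trace.re := by
    rw [← trace_conjTranspose_re, conjTranspose_mul, hsh.eq, conjTranspose_conjTranspose]
  have hzx : (zᴴ * x).trace.re = (xᴴ * z).trace.re := by
    rw [← trace_conjTranspose_re, conjTranspose_mul, conjTranspose_conjTranspose]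
  -- The missing traces serve as one extra coordinate for each vector, turning overlaps into
  -- generalized fidelities.
  obtain ⟨p, hp, hp2⟩ : ∃ p, p = √(1 - ρ.trace.re) ∧ p ^ 2 = 1 - ρ.trace.re :=
    ⟨_, rfl, Real.sq_sqrt (by linarith)⟩
  obtain ⟨q, hq, hq2⟩ : ∃ q, q = √(1 - σ.trace.re) ∧ q ^ 2 = 1 - σ.trace.re :=
    ⟨_, rfl, Real.sq_sqrt (by linarith)⟩
  obtain ⟨u, hu, hu2⟩ : ∃ u, u = √(1 - τ.trace.re) ∧ u ^ 2 = 1 - τ.trace.re :=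
    ⟨_, rfl, Real.sq_sqrt (by linarith)⟩
  have f1 : fidelity ρ σ = (xᴴ * s).trace.re + p * q := by
    rw [fidelity, Real.sqrt_mul (by linarith), hxy, hp, hq]
  have f2 : fidelity σ τ = (s * z).trace.re + q * u := by
    rw [fidelity, Real.sqrt_mul (by linarith), hyz, hq, hu]
  have f3 : (xᴴ * z).trace.re + p * u ≤ fidelity ρ τ := by
    rw [fidelity, Real.sqrt_mul (by linarith), hp, hu]
    linarith
  refine sqrt_one_sub_sq_le_add (fidelity_nonneg _ _) (fidelity_nonneg _ _) (fun α β κ => ?_) _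
    (fidelity_nonneg _ _) f3
  have h0 := trace_re_nonneg (posSemidef_conjTranspose_mul_self
    ((α : ℂ) • x + (β : ℂ) • s + (κ : ℂ) • z))
  simp only [conjTranspose_add, conjTranspose_smul, Matrix.add_mul, Matrix.mul_add,
    Matrix.smul_mul, Matrix.mul_smul, Matrix.trace_add, Matrix.trace_smul, Complex.add_re,
    Complex.star_def, Complex.conj_ofReal, smul_eq_mul, Complex.re_ofReal_mul, hsh.eq, hs,
    hyx, hzy, hzx] at h0
  rw [f1, f2]
  nlinarith [sq_nonneg (α * p + β * q + κ * u), mul_le_mul_of_nonneg_left hxx (sq_nonneg α),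
    mul_le_mul_of_nonneg_left hzz (sq_nonneg κ)]

/-- Guarantees that states in the ball have enough trace to survive filtering. -/
theorem one_sub_sq_le_trace {ρ τ : Matrix H H ℂ} (hρ : IsState ρ) (hτ : IsSubstate τ) {e : ℝ}
    (h : purifiedDistance ρ τ ≤ e) : 1 - e ^ 2 ≤ τ.trace.re := by
  have h1 := traceNorm_sqrt_sq_le hρ.1 hτ.1
  have h2 := (Real.sqrt_le_iff.1 h).2
  have h3 : fidelity ρ τ = traceNorm (CFC.sqrt ρ * CFC.sqrt τ) := by simp [fidelity, hρ.2]
  rw [h3] at h2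
  rw [hρ.2, Complex.one_re, one_mul] at h1
  linarith

end PurifiedDistance

/-! ### The spectral filter. -/

section Filter

variable {H : Type*} [Fintype H] [DecidableEq H]

/-- A filter `G` which maps `σ` below a multiple of the filtered version of `m`. -/
theorem exists_filter {m σ : Matrix H H ℂ} (hm : m.PosSemidef) (hσ : σ.PosSemidef)
    (hσ1 : σ.trace.re ≤ 1) {γ : ℝ} (hγ : 0 < γ) :
    ∃ G : Matrix H H ℂ, G * σ * Gᴴ ≤ γ • (G * m * Gᴴ) ∧ (m * G).trace = (G * m * Gᴴ).trace ∧
      m.trace.re - 1 / γ ≤ (G * m * Gᴴ).trace.re ∧ (G * m * Gᴴ).trace.re ≤ m.trace.re := by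
  have hS := (sqrt_posSemidef m).isHermitian
  have hSS := sqrt_mul_sqrt hm
  set S := CFC.sqrt m
  obtain ⟨R, hR, hc, h1, h2⟩ := exists_pseudoInverse hS
  have hΓ : (R * σ * R).PosSemidef := by simpa [hR.eq] using hσ.mul_mul_conjTranspose_same R
  obtain ⟨Q, hQ, hQQ, hQΓ, hΓQ, hQ1, hcomm⟩ := exists_spectral_cutoff hΓ γ
  -- `Q` also contains the kernel of `m`, where `Γ` vanishes, so commutation with the support
  -- projection `S * R` replaces `Q ≤ S * R`.
  have hP : Commute (R * σ * R) (S * R) := by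
    have e1 : R * σ * R * (S * R) = R * σ * R := by
      rw [Matrix.mul_assoc (R * σ), ← Matrix.mul_assoc R, h2]
    have e2 : S * R * (R * σ * R) = R * σ * R := by
      rw [← Matrix.mul_assoc, ← Matrix.mul_assoc, hc, h2]
    rw [Commute, SemiconjBy, e1, e2]
  have hQP : Q * (S * R) = S * R * Q := hcomm _ hP
  have hI : R * (S * S) * R = S * R := by rw [← Matrix.mul_assoc, ← hc, h1]
  have hG : S * Q * R * m * (S * Q * R)ᴴ = S * Q * S := by
    rw [conjTranspose_mul, conjTranspose_mul, hS.eq, hQ.eq, hR.eq, ← hSS]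
    calc S * Q * R * (S * S) * (R * (Q * S)) = S * (Q * (R * (S * S) * R)) * (Q * S) := by
          simp only [Matrix.mul_assoc]
      _ = S * (S * R) * (Q * Q) * S := by
          rw [hI, hQP]; simp only [Matrix.mul_assoc]
      _ = S * Q * S := by rw [hQQ, hc, ← Matrix.mul_assoc, h1]
  have htr : (S * Q * S).trace = (m * Q).trace := by
    rw [Matrix.mul_assoc, Matrix.trace_mul_comm, Matrix.mul_assoc, hSS, Matrix.trace_mul_comm]
  refine ⟨S * Q * R, ?_, ?_, ?_, ?_⟩
  · rw [hG, conjTranspose_mul, conjTranspose_mul, hS.eq, hQ.eq, hR.eq]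
    have := conj_le_conj hQΓ S
    rw [hS.eq, Matrix.mul_smul, Matrix.smul_mul] at this
    simpa only [Matrix.mul_assoc] using this
  · rw [hG, htr, ← hSS]
    have e : R * (S * S) * S = S * S := by rw [← Matrix.mul_assoc, ← hc, h1]
    rw [← Matrix.mul_assoc, Matrix.trace_mul_comm, ← Matrix.mul_assoc, ← Matrix.mul_assoc, e]
  · rw [hG]
    have h3 := trace_re_mono (conj_le_conj hΓQ S)
    -- `S Γ S` is `σ` compressed to the support of `m`. With `h3`, this bounds the lost trace by
    -- `1/γ`.
    have h4 : (S * (R * σ * R) * Sᴴ).trace.re ≤ 1 := by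
      refine le_trans ?_ hσ1
      have h6 := trace_re_mono (conj_le_conj (mul_pseudoInverse_le_one hS hR hc h1) (CFC.sqrt σ))
      rw [(sqrt_posSemidef σ).isHermitian.eq, Matrix.mul_one, sqrt_mul_sqrt hσ,
        Matrix.mul_assoc, Matrix.trace_mul_comm, Matrix.mul_assoc, sqrt_mul_sqrt hσ] at h6
      refine le_trans (le_of_eq ?_) h6
      rw [hS.eq, Matrix.trace_mul_comm, ← Matrix.mul_assoc, Matrix.trace_mul_comm,
        Matrix.mul_assoc (R * σ), ← Matrix.mul_assoc R, ← hc, h1, Matrix.trace_mul_comm,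
        ← Matrix.mul_assoc]
    rw [hS.eq, Matrix.mul_smul, Matrix.smul_mul, Matrix.trace_smul, Complex.smul_re,
      Matrix.mul_sub, Matrix.sub_mul, Matrix.mul_one, hSS, Matrix.trace_sub, Complex.sub_re,
      smul_eq_mul] at h3
    rw [hS.eq] at h4
    have h5 : m.trace.re - (S * Q * S).trace.re ≤ 1 / γ := by
      rw [le_div_iff₀ hγ]; linarith
    linarith
  · have := trace_re_mono (conj_le_conj hQ1 S)
    rwa [hS.eq, Matrix.mul_one, hSS, ← hG] at this

end Filter

/-! ### Partial traces, product operators and local filters. -/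

section Marginals

set_option linter.unusedSectionVars false

variable {A B : Type*} [Fintype A] [Fintype B]

theorem trace_margA (ρ : Matrix (A × B) (A × B) ℂ) : (margA ρ).trace = ρ.trace := by
  simp [margA, Matrix.trace, Fintype.sum_prod_type]

theorem trace_margB (ρ : Matrix (A × B) (A × B) ℂ) : (margB ρ).trace = ρ.trace := by
  simp only [margB, Matrix.trace, Fintype.sum_prod_type, Matrix.diag, Matrix.of_apply]
  rw [Finset.sum_comm]

theorem margA_add (ρ σ : Matrix (A × B) (A × B) ℂ) : margA (ρ + σ) = margA ρ + margA σ := by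
  ext; simp [margA, Finset.sum_add_distrib]

theorem margB_add (ρ σ : Matrix (A × B) (A × B) ℂ) : margB (ρ + σ) = margB ρ + margB σ := by
  ext; simp [margB, Finset.sum_add_distrib]

theorem margA_smul (c : ℝ) (ρ : Matrix (A × B) (A × B) ℂ) : margA (c • ρ) = c • margA ρ := by
  ext; simp [margA, Finset.mul_sum]

theorem margB_smul (c : ℝ) (ρ : Matrix (A × B) (A × B) ℂ) : margB (c • ρ) = c • margB ρ := by
  ext; simp [margB, Finset.mul_sum]

theorem margA_kronecker (M : Matrix A A ℂ) (N : Matrix B B ℂ) :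
    margA (M ⊗ₖ N) = N.trace • M := by
  ext a a'; simp [margA, Matrix.trace, ← Finset.mul_sum, mul_comm]

theorem margB_kronecker (M : Matrix A A ℂ) (N : Matrix B B ℂ) :
    margB (M ⊗ₖ N) = M.trace • N := by
  ext a a'; simp [margB, Matrix.trace, ← Finset.sum_mul]

theorem margA_posSemidef {ρ : Matrix (A × B) (A × B) ℂ} (h : ρ.PosSemidef) :
    (margA ρ).PosSemidef := by
  have : margA ρ = ∑ b, ρ.submatrix (fun a => (a, b)) (fun a => (a, b)) := by
    ext a a'; simp [margA, Matrix.sum_apply]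
  rw [this]
  exact posSemidef_sum _ fun b _ => h.submatrix _

theorem margB_posSemidef {ρ : Matrix (A × B) (A × B) ℂ} (h : ρ.PosSemidef) :
    (margB ρ).PosSemidef := by
  have : margB ρ = ∑ a, ρ.submatrix (fun b => (a, b)) (fun b => (a, b)) := by
    ext a a'; simp [margB, Matrix.sum_apply]
  rw [this]
  exact posSemidef_sum _ fun b _ => h.submatrix _

theorem kronecker_mono_left {M M' : Matrix A A ℂ} {N : Matrix B B ℂ} (h : M ≤ M')
    (hN : N.PosSemidef) : M ⊗ₖ N ≤ M' ⊗ₖ N := by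
  rw [Matrix.le_iff] at *
  convert h.kronecker hN using 1
  ext ⟨_, _⟩ ⟨_, _⟩; simp [sub_mul]

theorem kronecker_mono_right {M : Matrix A A ℂ} {N N' : Matrix B B ℂ} (hM : M.PosSemidef)
    (h : N ≤ N') : M ⊗ₖ N ≤ M ⊗ₖ N' := by
  rw [Matrix.le_iff] at *
  convert hM.kronecker h using 1
  ext ⟨_, _⟩ ⟨_, _⟩; simp [mul_sub]

variable [DecidableEq A] [DecidableEq B]

theorem margA_filter (G : Matrix A A ℂ) (ρ : Matrix (A × B) (A × B) ℂ) :
    margA ((G ⊗ₖ (1 : Matrix B B ℂ)) * ρ * (G ⊗ₖ (1 : Matrix B B ℂ))ᴴ) = G * margA ρ * Gᴴ := by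
  ext a a'
  simp [margA, Matrix.mul_apply, Fintype.sum_prod_type, Matrix.one_apply, conjTranspose_kronecker,
    Finset.sum_mul, Finset.mul_sum]
  rw [Finset.sum_comm]
  exact Finset.sum_congr rfl fun _ _ => Finset.sum_comm

theorem margB_filter (G : Matrix B B ℂ) (ρ : Matrix (A × B) (A × B) ℂ) :
    margB (((1 : Matrix A A ℂ) ⊗ₖ G) * ρ * ((1 : Matrix A A ℂ) ⊗ₖ G)ᴴ) = G * margB ρ * Gᴴ := by
  ext a a'
  simp [margB, Matrix.mul_apply, Fintype.sum_prod_type, Matrix.one_apply, conjTranspose_kronecker,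
    Finset.sum_mul, Finset.mul_sum]
  rw [Finset.sum_comm]
  exact Finset.sum_congr rfl fun _ _ => Finset.sum_comm

theorem trace_mul_kronecker_one (G : Matrix A A ℂ) (ρ : Matrix (A × B) (A × B) ℂ) :
    (ρ * (G ⊗ₖ (1 : Matrix B B ℂ))).trace = (margA ρ * G).trace := by
  simp [margA, Matrix.trace, Matrix.mul_apply, Fintype.sum_prod_type, Matrix.one_apply,
    Finset.sum_mul]
  exact Finset.sum_congr rfl fun _ _ => Finset.sum_comm

theorem trace_mul_one_kronecker (G : Matrix B B ℂ) (ρ : Matrix (A × B) (A × B) ℂ) :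
    (ρ * ((1 : Matrix A A ℂ) ⊗ₖ G)).trace = (margB ρ * G).trace := by
  simp [margB, Matrix.trace, Matrix.mul_apply, Fintype.sum_prod_type, Matrix.one_apply,
    Finset.sum_mul]
  rw [Finset.sum_comm]
  exact Finset.sum_congr rfl fun _ _ => Finset.sum_comm

end Marginals
-- Fidelity under filtering and mixing.
section Perturbation

variable {H : Type*} [Fintype H] [DecidableEq H]

/-- The factors `√ρ` and `K √ρ` have overlap `tr (ρ K)`, which `hK` turns into the output trace; the
trace defect contributes at least `1 - tr ρ`. -/
theorem le_fidelity_filter {ρ K : Matrix H H ℂ} (hρ : IsSubstate ρ)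
    (hK : (ρ * K).trace = (K * ρ * Kᴴ).trace) (hle : (K * ρ * Kᴴ).trace.re ≤ ρ.trace.re) :
    1 - ρ.trace.re + (K * ρ * Kᴴ).trace.re ≤ fidelity ρ (K * ρ * Kᴴ) := by
  have hS := (sqrt_posSemidef ρ).isHermitian
  have hSS := sqrt_mul_sqrt hρ.1
  have h1 : 1 - ρ.trace.re ≤ √((1 - ρ.trace.re) * (1 - (K * ρ * Kᴴ).trace.re)) := by
    apply Real.le_sqrt_of_sq_le
    nlinarith [hρ.2.2]
  have h2 := trace_le_traceNorm_sqrt (X := CFC.sqrt ρ) (Z := K * CFC.sqrt ρ) hρ.1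
    (hρ.1.mul_mul_conjTranspose_same K) (by rw [hS.eq, hSS])
    (le_of_eq (by rw [conjTranspose_mul, hS.eq, Matrix.mul_assoc, ← Matrix.mul_assoc _ _ Kᴴ, hSS,
      Matrix.mul_assoc]))
  rw [hS.eq, Matrix.trace_mul_comm, Matrix.mul_assoc, hSS, Matrix.trace_mul_comm, hK] at h2
  rw [fidelity]
  linarith

/-- The mixture dominates `(1 - δ) ρ`, so `√(1 - δ) √ρ` is an admissible factor; `tr ω ≤ 1` gives
the matching bound on the trace defects. -/
theorem sqrt_le_fidelity_mix {ρ ω : Matrix H H ℂ} (hρ : IsSubstate ρ) (hω : ω.PosSemidef)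
    (hω1 : ω.trace.re ≤ 1) {δ : ℝ} (hδ : 0 ≤ δ) (hδ1 : δ ≤ 1) :
    √(1 - δ) ≤ fidelity ρ ((1 - δ) • ρ + δ • ω) := by
  have hS := (sqrt_posSemidef ρ).isHermitian
  have hSS := sqrt_mul_sqrt hρ.1
  have hδ' : 0 ≤ 1 - δ := sub_nonneg.2 hδ1
  have hq := Real.sqrt_nonneg (1 - δ)
  have h1 : √(1 - δ) * (1 - ρ.trace.re) ≤
      √((1 - ρ.trace.re) * (1 - ((1 - δ) • ρ + δ • ω).trace.re)) := by
    apply Real.le_sqrt_of_sq_le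
    rw [mul_pow, Real.sq_sqrt hδ', Matrix.trace_add, Matrix.trace_smul, Matrix.trace_smul,
      Complex.add_re, Complex.smul_re, Complex.smul_re, smul_eq_mul, smul_eq_mul]
    nlinarith [mul_nonneg (mul_nonneg hδ (sub_nonneg.2 hω1)) (sub_nonneg.2 hρ.2.2)]
  have h2 := trace_le_traceNorm_sqrt (X := CFC.sqrt ρ) (Z := √(1 - δ) • CFC.sqrt ρ) hρ.1
    ((hρ.1.smul hδ').add (hω.smul hδ)) (by rw [hS.eq, hSS])
    (by
      rw [conjTranspose_smul, hS.eq, Matrix.smul_mul, Matrix.mul_smul, hSS, smul_smul, star_trivial,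
        Real.mul_self_sqrt hδ']
      exact le_add_of_nonneg_right (Matrix.nonneg_iff_posSemidef.2 (hω.smul hδ)))
  rw [hS.eq, Matrix.mul_smul, hSS, Matrix.trace_smul, Complex.smul_re, smul_eq_mul] at h2
  rw [fidelity]
  linarith

end Perturbation

/-! ### Replacing product factors by marginals. -/

section Bounds

variable {A B : Type*} [Fintype A] [Fintype B]

/-- Mixing a state with the product `α ⊗ τ_B` enlarges both marginals. -/
theorem mix_le_marg_kronecker_marg {τ : Matrix (A × B) (A × B) ℂ} (hτ : IsSubstate τ)
    {α : Matrix A A ℂ} (hα : α.PosSemidef) (hαt : τ.trace.re ≤ α.trace.re) {c δ : ℝ} (hc : 0 ≤ c)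
    (hδ : 0 < δ) (hδ1 : δ ≤ 1) (h : τ ≤ c • (α ⊗ₖ margB τ)) :
    (1 - δ) • τ + δ • (τ.trace.re⁻¹ • (α ⊗ₖ margB τ)) ≤
      (c / δ + τ.trace.re⁻¹) •
        (margA ((1 - δ) • τ + δ • (τ.trace.re⁻¹ • (α ⊗ₖ margB τ))) ⊗ₖ
          margB ((1 - δ) • τ + δ • (τ.trace.re⁻¹ • (α ⊗ₖ margB τ)))) := by
  set s := τ.trace.re with hs
  have hs0 : 0 < s := hτ.2.1
  have hsc : τ.trace = (s : ℂ) := by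
    refine Complex.ext rfl ?_
    rw [Complex.ofReal_im]
    exact (Complex.le_def.1 hτ.1.trace_nonneg).2.symm
  have hac : α.trace = (α.trace.re : ℂ) := by
    refine Complex.ext rfl ?_
    rw [Complex.ofReal_im]
    exact (Complex.le_def.1 hα.trace_nonneg).2.symm
  have hB := margB_posSemidef hτ.1
  have hδ' : 0 ≤ 1 - δ := sub_nonneg.2 hδ1
  have hmA : δ • α ≤ margA ((1 - δ) • τ + δ • (s⁻¹ • (α ⊗ₖ margB τ))) := by
    rw [margA_add, margA_smul, margA_smul, margA_smul, margA_kronecker, trace_margB, hsc,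
      Complex.coe_smul, smul_smul s⁻¹, inv_mul_cancel₀ hs0.ne', one_smul]
    exact le_add_of_nonneg_left
      (Matrix.nonneg_iff_posSemidef.2 ((margA_posSemidef hτ.1).smul hδ'))
  -- The product contributes `δ (tr α / tr τ) τ_B`, and `tr α ≥ tr τ` makes up for the weight
  -- removed from `τ`.
  have hmB : margB τ ≤ margB ((1 - δ) • τ + δ • (s⁻¹ • (α ⊗ₖ margB τ))) := by
    rw [margB_add, margB_smul, margB_smul, margB_smul, margB_kronecker, hac,
      Complex.coe_smul, smul_smul, smul_smul, ← add_smul]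
    nth_rw 1 [← one_smul ℝ (margB τ)]
    refine smul_le_smul_of_posSemidef hB ?_
    have : 1 ≤ s⁻¹ * α.trace.re := by
      rw [inv_mul_eq_div, one_le_div hs0]; exact hαt
    nlinarith
  have hprod := (kronecker_mono_left hmA hB).trans
    (kronecker_mono_right (Matrix.nonneg_iff_posSemidef.1
      ((Matrix.nonneg_iff_posSemidef.2 (hα.smul hδ.le)).trans hmA)) hmB)
  have hαB := hα.kronecker hB
  have h1 : (1 - δ) • τ + δ • (s⁻¹ • (α ⊗ₖ margB τ)) ≤ (c + δ * s⁻¹) • (α ⊗ₖ margB τ) := by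
    rw [add_smul, smul_smul]
    refine add_le_add_left ((smul_le_smul_of_le h hδ').trans ?_) _
    rw [smul_smul]
    exact smul_le_smul_of_posSemidef hαB (by nlinarith)
  refine h1.trans ?_
  have h2 := smul_le_smul_of_le hprod (c := c / δ + s⁻¹) (by positivity)
  refine le_trans (le_of_eq ?_) h2
  rw [smul_kronecker, smul_smul]
  congr 1
  field_simp

variable [DecidableEq A] [DecidableEq B]

theorem exists_filter_margA {ρ : Matrix (A × B) (A × B) ℂ} (hρ : IsSubstate ρ)
    {σA : Matrix A A ℂ} {σB : Matrix B B ℂ} (hA : IsState σA) (hB : σB.PosSemidef) {c γ : ℝ}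
    (hc : 0 ≤ c) (hγ : 0 < γ) (hργ : 1 / γ < ρ.trace.re) (h : ρ ≤ c • (σA ⊗ₖ σB)) :
    ∃ τ : Matrix (A × B) (A × B) ℂ, IsSubstate τ ∧ 1 - 1 / γ ≤ fidelity ρ τ ∧
      τ ≤ (c * γ) • (margA τ ⊗ₖ σB) := by
  obtain ⟨G, hG1, hG2, hG3, hG4⟩ := exists_filter (margA_posSemidef hρ.1) hA.1
    (by simp [hA.2]) hγ
  set K : Matrix (A × B) (A × B) ℂ := G ⊗ₖ (1 : Matrix B B ℂ) with hK
  have ht : (K * ρ * Kᴴ).trace = (G * margA ρ * Gᴴ).trace := by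
    rw [← trace_margA, hK, margA_filter]
  rw [trace_margA] at hG3 hG4
  rw [← ht] at hG2 hG3 hG4
  have hF := le_fidelity_filter (K := K) hρ (by rw [← hG2, hK, trace_mul_kronecker_one]) hG4
  refine ⟨K * ρ * Kᴴ, ⟨hρ.1.mul_mul_conjTranspose_same K, by linarith, hG4.trans hρ.2.2⟩,
    by linarith, ?_⟩
  have h1 := conj_le_conj h K
  have e : K * (σA ⊗ₖ σB) * Kᴴ = (G * σA * Gᴴ) ⊗ₖ σB := by
    rw [hK, conjTranspose_kronecker, ← mul_kronecker_mul, ← mul_kronecker_mul]; simp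
  rw [Matrix.mul_smul, Matrix.smul_mul, e] at h1
  refine h1.trans ?_
  rw [hK, margA_filter, mul_smul, ← smul_kronecker γ]
  exact smul_le_smul_of_le (kronecker_mono_left hG1 hB) hc

theorem exists_filter_margB {ρ : Matrix (A × B) (A × B) ℂ} (hρ : IsSubstate ρ)
    {α : Matrix A A ℂ} {σB : Matrix B B ℂ} (hα : α.PosSemidef) (hB : IsState σB) {c γ : ℝ}
    (hc : 0 ≤ c) (hγ : 0 < γ) (hργ : 1 / γ < ρ.trace.re) (h : ρ ≤ c • (α ⊗ₖ σB)) :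
    ∃ τ : Matrix (A × B) (A × B) ℂ, IsSubstate τ ∧ 1 - 1 / γ ≤ fidelity ρ τ ∧
      ρ.trace.re - 1 / γ ≤ τ.trace.re ∧ τ.trace.re ≤ ρ.trace.re ∧
      τ ≤ (c * γ) • (α ⊗ₖ margB τ) := by
  obtain ⟨G, hG1, hG2, hG3, hG4⟩ := exists_filter (margB_posSemidef hρ.1) hB.1
    (by simp [hB.2]) hγ
  set K : Matrix (A × B) (A × B) ℂ := (1 : Matrix A A ℂ) ⊗ₖ G with hK
  have ht : (K * ρ * Kᴴ).trace = (G * margB ρ * Gᴴ).trace := by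
    rw [← trace_margB, hK, margB_filter]
  rw [trace_margB] at hG3 hG4
  rw [← ht] at hG2 hG3 hG4
  have hF := le_fidelity_filter (K := K) hρ (by rw [← hG2, hK, trace_mul_one_kronecker]) hG4
  refine ⟨K * ρ * Kᴴ, ⟨hρ.1.mul_mul_conjTranspose_same K, by linarith, hG4.trans hρ.2.2⟩,
    by linarith, hG3, hG4, ?_⟩
  have h1 := conj_le_conj h K
  have e : K * (α ⊗ₖ σB) * Kᴴ = α ⊗ₖ (G * σB * Gᴴ) := by
    rw [hK, conjTranspose_kronecker, ← mul_kronecker_mul, ← mul_kronecker_mul]; simp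
  rw [Matrix.mul_smul, Matrix.smul_mul, e] at h1
  refine h1.trans ?_
  rw [hK, margB_filter, mul_smul, ← kronecker_smul γ]
  exact smul_le_smul_of_le (kronecker_mono_right hα hG1) hc

/-- Filtering on `B` and then mixing with weight `ε` each cost at most `√ε` in distance; the extra
`ε` in the radius is slack. -/
theorem exists_near_product_marginals {ρ : Matrix (A × B) (A × B) ℂ} (hρ : IsSubstate ρ)
    {σB : Matrix B B ℂ} (hB : IsState σB) {c ε : ℝ} (hε : 0 < ε) (hε1 : ε ≤ 1)
    (hρε : ε + 2 * √ε ≤ ρ.trace.re) (h : ρ ≤ c • (margA ρ ⊗ₖ σB)) :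
    ∃ τ : Matrix (A × B) (A × B) ℂ, IsSubstate τ ∧ purifiedDistance ρ τ ≤ ε + 2 * √ε ∧
      τ ≤ (c * (3 / ε ^ 2)) • (margA τ ⊗ₖ margB τ) := by
  have hq : 0 < √ε := Real.sqrt_pos.2 hε
  have hqq : √ε ^ 2 = ε := Real.sq_sqrt hε.le
  -- Comparing traces in `h`; this later lets the additive `1 / tr τ` be absorbed into a multiple of
  -- `c`.
  have hc : 1 ≤ c := by
    have := trace_re_mono h
    rw [Matrix.trace_smul, trace_kronecker, trace_margA, hB.2, mul_one, Complex.smul_re,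
      smul_eq_mul] at this
    by_contra hlt
    nlinarith [hρ.2.1]
  -- The cutoff `2/ε` loses trace at most `ε/2`, so the squared fidelity is at least `(1 - ε/2)² ≥ 1
  -- - ε`.
  have hγ : 1 / (2 / ε) = ε / 2 := by field_simp
  obtain ⟨τ, hτ, hF, hs, hs1, hle⟩ := exists_filter_margB hρ (margA_posSemidef hρ.1) hB
    (c := c) (γ := 2 / ε) (by linarith) (by positivity) (by rw [hγ]; linarith) h
  rw [hγ] at hF hs
  have hτA : τ.trace.re ≤ (margA ρ).trace.re := by rwa [trace_margA]
  have hle' := mix_le_marg_kronecker_marg hτ (margA_posSemidef hρ.1) hτA (δ := ε)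
    (by positivity) hε hε1 hle
  have hωp : (τ.trace.re⁻¹ • (margA ρ ⊗ₖ margB τ)).PosSemidef :=
    ((margA_posSemidef hρ.1).kronecker (margB_posSemidef hτ.1)).smul (inv_nonneg.2 hτ.2.1.le)
  have hω : (τ.trace.re⁻¹ • (margA ρ ⊗ₖ margB τ)).trace.re = ρ.trace.re := by
    have him : ρ.trace.im = 0 := (Complex.le_def.1 hρ.1.trace_nonneg).2.symm
    rw [Matrix.trace_smul, trace_kronecker, trace_margA, trace_margB, Complex.smul_re,
      Complex.mul_re, him, smul_eq_mul]
    have := hτ.2.1.ne'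
    field_simp
    ring
  set ω := τ.trace.re⁻¹ • (margA ρ ⊗ₖ margB τ)
  have hP2 : purifiedDistance τ ((1 - ε) • τ + ε • ω) ≤ √ε := by
    refine purifiedDistance_le hq.le (Real.sqrt_nonneg _)
      (sqrt_le_fidelity_mix hτ hωp (by rw [hω]; exact hρ.2.2) hε.le hε1) ?_
    rw [hqq, Real.sq_sqrt (by linarith)]
  have hP1 : purifiedDistance ρ τ ≤ √ε := by
    refine purifiedDistance_le hq.le (by linarith) hF ?_
    rw [hqq]; nlinarith
  have htr : ((1 - ε) • τ + ε • ω).trace.re = (1 - ε) * τ.trace.re + ε * ρ.trace.re := by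
    rw [Matrix.trace_add, Matrix.trace_smul, Matrix.trace_smul, Complex.add_re, Complex.smul_re,
      Complex.smul_re, smul_eq_mul, smul_eq_mul, hω]
  have hτ' : IsSubstate ((1 - ε) • τ + ε • ω) := by
    refine ⟨(hτ.1.smul (sub_nonneg.2 hε1)).add (hωp.smul hε.le), ?_, ?_⟩
    · rw [htr]
      have := mul_pos hε hρ.2.1
      have := mul_nonneg (sub_nonneg.2 hε1) hτ.2.1.le
      linarith
    · rw [htr]; nlinarith [hτ.2.2, hρ.2.2]
  refine ⟨_, hτ', ?_, hle'.trans (smul_le_smul_of_posSemidef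
    ((margA_posSemidef hτ'.1).kronecker (margB_posSemidef hτ'.1)) ?_)⟩
  · have := purifiedDistance_triangle hρ hτ hτ'
    linarith
  · have hq1 : √ε ≤ 1 := Real.sqrt_le_one.2 hε1
    have hs3 : ε ^ 2 ≤ τ.trace.re := by
      have : ε ^ 2 ≤ ε := by nlinarith
      have : ε ≤ √ε := by nlinarith
      linarith
    have h4 : τ.trace.re⁻¹ ≤ (ε ^ 2)⁻¹ := inv_anti₀ (by positivity) hs3
    have h5 : (ε ^ 2)⁻¹ ≤ c * (ε ^ 2)⁻¹ := le_mul_of_one_le_left (by positivity) hc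
    have h6 : c * (2 / ε) / ε = 2 * (c * (ε ^ 2)⁻¹) := by field_simp
    have h7 : c * (3 / ε ^ 2) = 3 * (c * (ε ^ 2)⁻¹) := by field_simp
    linarith

end Bounds

theorem dmax_le {H : Type*} [Fintype H] {ρ σ : Matrix H H ℂ} (hσ : σ.PosSemidef) {c x : ℝ}
    (h : ρ ≤ c • σ) (hc : c ≤ 2 ^ x) : dmax ρ σ ≤ (x : EReal) :=
  iInf₂_le x (h.trans (smul_le_smul_of_posSemidef hσ hc))

theorem dmax_mono_right {H : Type*} [Fintype H] {ρ σ τ : Matrix H H ℂ} (h : σ ≤ τ) :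
    dmax ρ τ ≤ dmax ρ σ :=
  le_iInf₂ fun x hx => iInf₂_le x (hx.trans (smul_le_smul_of_le h (by positivity)))

/-- Every substate is dominated by its normalization. -/
theorem exists_isState_ge {H : Type*} [Fintype H] {ρ : Matrix H H ℂ} (h : IsSubstate ρ) :
    ∃ σ, IsState σ ∧ ρ ≤ σ := by
  obtain ⟨hρ, h0, h1⟩ := h
  refine ⟨ρ.trace.re⁻¹ • ρ, ⟨hρ.smul (inv_nonneg.2 h0.le), ?_⟩, ?_⟩
  · have him : ρ.trace.im = 0 := (Complex.le_def.1 hρ.trace_nonneg).2.symm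
    rw [Matrix.trace_smul]
    apply Complex.ext
    · simp [h0.ne']
    · simp [him]
  · nth_rw 1 [← one_smul ℝ ρ]
    exact smul_le_smul_of_posSemidef hρ ((one_le_inv₀ h0).2 h1)

/-! ### Comparison of the smooth quantities. -/

section Smooth

variable {A B : Type*} [Fintype A] [Fintype B]

theorem isSubstate_margA {ρ : Matrix (A × B) (A × B) ℂ} (h : IsSubstate ρ) :
    IsSubstate (margA ρ) :=
  ⟨margA_posSemidef h.1, by rw [trace_margA]; exact h.2⟩

theorem isSubstate_margB {ρ : Matrix (A × B) (A × B) ℂ} (h : IsSubstate ρ) :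
    IsSubstate (margB ρ) :=
  ⟨margB_posSemidef h.1, by rw [trace_margB]; exact h.2⟩

theorem imax3_le_imax2 {ρ : Matrix (A × B) (A × B) ℂ} (h : IsSubstate ρ) :
    imax3 ρ ≤ imax2 ρ := by
  obtain ⟨σ, hσ, hle⟩ := exists_isState_ge (isSubstate_margA h)
  exact iInf₂_le_of_le σ hσ
    (iInf₂_mono fun σB hB => dmax_mono_right (kronecker_mono_left hle hB.1))

theorem imax2_le_imax1 {ρ : Matrix (A × B) (A × B) ℂ} (h : IsSubstate ρ) :
    imax2 ρ ≤ imax1 ρ := by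
  obtain ⟨σ, hσ, hle⟩ := exists_isState_ge (isSubstate_margB h)
  exact iInf₂_le_of_le σ hσ
    (dmax_mono_right (kronecker_mono_right (margA_posSemidef h.1) hle))

theorem smooth_mono {H : Type*} [Fintype H] [DecidableEq H] {I J : Matrix H H ℂ → EReal}
    (h : ∀ ρ, IsSubstate ρ → I ρ ≤ J ρ) (ε : ℝ) (ρ : Matrix H H ℂ) :
    smooth I ε ρ ≤ smooth J ε ρ :=
  iInf₂_mono fun τ hτ => h τ hτ.1

theorem isSubstate_of_isState {H : Type*} [Fintype H] {ρ : Matrix H H ℂ} (h : IsState ρ) :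
    IsSubstate ρ :=
  ⟨h.1, by simp [h.2], by simp [h.2]⟩

variable [DecidableEq A] [DecidableEq B]

theorem smoothImax2_le_smoothImax3_add {ρ : Matrix (A × B) (A × B) ℂ} (hρ : IsState ρ)
    {ε' ε'' : ℝ} (hε' : 0 < ε') (hε'' : 0 ≤ ε'') (hsmall : ε' + ε'' < 1) :
    smoothImax2 (ε' + ε'') ρ ≤ smoothImax3 ε'' ρ + (fTerm ε' ε'' : EReal) := by
  have hr0 : 0 < 1 - √(1 - ε' ^ 2) := by
    rw [sub_pos, Real.sqrt_lt' one_pos]; nlinarith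
  have hr1 : 1 - ε' ^ 2 ≤ √(1 - ε' ^ 2) := by
    apply Real.le_sqrt_of_sq_le
    nlinarith [mul_nonneg (sq_nonneg ε') (show 0 ≤ 1 - ε' ^ 2 by nlinarith)]
  have hrs : √(1 - ε' ^ 2) ^ 2 = 1 - ε' ^ 2 := Real.sq_sqrt (by nlinarith)
  -- Chosen so that the fidelity bound `1 - 1/γ` equals `√(1 - ε'²)`, that is, distance at most
  -- `ε'`.
  set γ := 1 / (1 - √(1 - ε' ^ 2)) with hγ
  have hγ0 : 0 < γ := one_div_pos.2 hr0
  have hγi : 1 / γ = 1 - √(1 - ε' ^ 2) := by rw [hγ, one_div_one_div]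
  have hpow : (2 : ℝ) ^ fTerm ε' ε'' = γ + 1 / (1 - ε'') :=
    Real.rpow_logb two_pos (by norm_num)
      (add_pos hγ0 (one_div_pos.2 (by linarith)))
  -- Moving the finite term across lets the infima on the right be unpacked, with no need for a
  -- minimizer.
  rw [← EReal.sub_le_iff_le_add (by simp) (by simp)]
  refine le_iInf₂ fun σ hσ => le_iInf₂ fun σA hA => le_iInf₂ fun σB hB => le_iInf₂ fun x hx => ?_
  rw [EReal.sub_le_iff_le_add (by simp) (by simp), ← EReal.coe_add]
  have htr := one_sub_sq_le_trace hρ hσ.1 hσ.2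
  -- Here `1/γ ≤ ε'²` and `tr σ ≥ 1 - ε''²`, while `ε' + ε'' < 1`.
  have hlt : 1 / γ < σ.trace.re := by rw [hγi]; nlinarith
  obtain ⟨τ, hτ, hF, hle⟩ :=
    exists_filter_margA hσ.1 hA hB.1 (by positivity) hγ0 hlt hx
  have hP : purifiedDistance σ τ ≤ ε' := by
    refine purifiedDistance_le hε'.le (Real.sqrt_nonneg (1 - ε' ^ 2)) ?_ hrs.ge
    rw [hγi] at hF; linarith
  have htri := purifiedDistance_triangle (isSubstate_of_isState hρ) hσ.1 hτ
  refine iInf₂_le_of_le τ ⟨hτ, by linarith [hσ.2]⟩ (iInf₂_le_of_le σB hB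
    (dmax_le ((margA_posSemidef hτ.1).kronecker hB.1) hle ?_))
  rw [Real.rpow_add two_pos, hpow]
  -- The factor `γ` alone suffices; the second summand inside `fTerm` is slack.
  have : 0 ≤ 1 / (1 - ε'') := one_div_nonneg.2 (by linarith)
  gcongr
  linarith

theorem smoothImax1_le_smoothImax2_add {ρ : Matrix (A × B) (A × B) ℂ} (hρ : IsState ρ)
    {ε ε'' : ℝ} (hε : 0 < ε) (hε'' : 0 ≤ ε'') (hsmall : ε + 2 * √ε + ε'' < 1) :
    smoothImax1 (ε + 2 * √ε + ε'') ρ ≤ smoothImax2 ε'' ρ + (gTerm ε : EReal) := by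
  have hq : 0 < √ε := Real.sqrt_pos.2 hε
  have hε1 : ε < 1 := by linarith
  have hr0 : 0 < 1 - √(1 - ε ^ 2) := by
    rw [sub_pos, Real.sqrt_lt' one_pos]; nlinarith
  have hr1 : 1 - ε ^ 2 ≤ √(1 - ε ^ 2) := by
    apply Real.le_sqrt_of_sq_le
    nlinarith [mul_nonneg (sq_nonneg ε) (show 0 ≤ 1 - ε ^ 2 by nlinarith)]
  have hpow : (2 : ℝ) ^ gTerm ε = (2 * (1 - ε) + 3) / ((1 - ε) * (1 - √(1 - ε ^ 2))) :=
    Real.rpow_logb two_pos (by norm_num)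
      (div_pos (by linarith) (mul_pos (by linarith) hr0))
  -- The numerator in `gTerm` is at least `3`, and `1 - √(1 - ε²) ≤ ε²` bounds its denominator.
  have hg : 3 / ε ^ 2 ≤ (2 : ℝ) ^ gTerm ε := by
    rw [hpow]
    refine div_le_div₀ (by linarith) (by linarith) (mul_pos (by linarith) hr0) ?_
    nlinarith
  rw [← EReal.sub_le_iff_le_add (by simp) (by simp)]
  refine le_iInf₂ fun σ hσ => le_iInf₂ fun σB hB => le_iInf₂ fun x hx => ?_
  rw [EReal.sub_le_iff_le_add (by simp) (by simp), ← EReal.coe_add]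
  have htr := one_sub_sq_le_trace hρ hσ.1 hσ.2
  obtain ⟨τ, hτ, hP, hle⟩ := exists_near_product_marginals hσ.1 hB hε hε1.le (by nlinarith) hx
  have htri := purifiedDistance_triangle (isSubstate_of_isState hρ) hσ.1 hτ
  refine iInf₂_le_of_le τ ⟨hτ, by linarith [hσ.2]⟩
    (dmax_le ((margA_posSemidef hτ.1).kronecker (margB_posSemidef hτ.1)) hle ?_)
  rw [Real.rpow_add two_pos]
  gcongr

end Smooth

end MaxInfo

theorem mainTheorem3 {A B : Type*} [Fintype A] [DecidableEq A] [Fintype B] [DecidableEq B]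
    (ρ : Matrix (A × B) (A × B) ℂ) (hρ : MaxInfo.IsState ρ)
    (ε ε' ε'' : ℝ) (hε : 0 < ε) (hε' : 0 < ε') (hε'' : 0 ≤ ε'')
    (hsmall : ε + 2 * Real.sqrt ε + ε' + ε'' < 1) :
    (MaxInfo.smoothImax3 (ε + 2 * Real.sqrt ε + ε' + ε'') ρ ≤
        MaxInfo.smoothImax1 (ε + 2 * Real.sqrt ε + ε' + ε'') ρ ∧
      MaxInfo.smoothImax1 (ε + 2 * Real.sqrt ε + ε' + ε'') ρ ≤
        MaxInfo.smoothImax3 ε'' ρ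
          + (MaxInfo.fTerm ε' ε'' : EReal) + (MaxInfo.gTerm ε : EReal)) ∧
    (MaxInfo.smoothImax3 (ε' + ε'') ρ ≤ MaxInfo.smoothImax2 (ε' + ε'') ρ ∧
      MaxInfo.smoothImax2 (ε' + ε'') ρ ≤
        MaxInfo.smoothImax3 ε'' ρ + (MaxInfo.fTerm ε' ε'' : EReal)) ∧
    (MaxInfo.smoothImax2 (ε + 2 * Real.sqrt ε + ε'') ρ ≤
        MaxInfo.smoothImax1 (ε + 2 * Real.sqrt ε + ε'') ρ ∧
      MaxInfo.smoothImax1 (ε + 2 * Real.sqrt ε + ε'') ρ ≤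
        MaxInfo.smoothImax2 ε'' ρ + (MaxInfo.gTerm ε : EReal)) := by
  have hq : 0 ≤ √ε := Real.sqrt_nonneg ε
  have h23 := MaxInfo.smoothImax2_le_smoothImax3_add hρ hε' hε'' (by linarith)
  refine ⟨⟨?_, ?_⟩, ⟨?_, h23⟩, ⟨?_, ?_⟩⟩
  · exact MaxInfo.smooth_mono
      (fun _ h => (MaxInfo.imax3_le_imax2 h).trans (MaxInfo.imax2_le_imax1 h)) _ _
  -- The two comparisons are chained at the intermediate radius `ε' + ε''`.
  · have h12 := MaxInfo.smoothImax1_le_smoothImax2_add hρ hε (ε'' := ε' + ε'') (by linarith)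
      (by linarith)
    rw [← add_assoc] at h12
    exact h12.trans (add_le_add_left h23 _)
  · exact MaxInfo.smooth_mono (fun _ => MaxInfo.imax3_le_imax2) _ _
  · exact MaxInfo.smooth_mono (fun _ => MaxInfo.imax2_le_imax1) _ _
  · exact MaxInfo.smoothImax1_le_smoothImax2_add hρ hε hε'' (by linarith)
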